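/- Setting. Fix a propagation speed $c_0>0$, a center frequency $\omega_c$ and a bandwidth $B$ with $0<B/2<\omega_c$, an aperture $A\in(0,2\pi]$, an elevation angle $\phi\in[0,\pi/2)$, a pixel spacing $\Delta>0$, and constants $C>0$, $\varepsilon>0$. A scene consists of the $K=n^2$ points $\mathbf x_k$ of the $n\times n$ grid of spacing $\Delta$ in the ground plane, centered at the origin, and has side length $L=\sqrt K\,\Delta$. There are $N\ge2$ receivers with look directions $\hat{\mathbf a}_i=(\cos\phi\cos\theta_i,\cos\phi\sin\theta_i,\sin\phi)$, $\theta_i=Ai/N$, $0\le i<N$, a transmitter with look direction $\hat{\mathbf a}^t=(\cos\phi,0,\sin\phi)$, and $M\ge1$ frequency samples $\omega_m=\omega_c-\frac B2+\frac{m}{M}B$, $0\le m<M$. Put $\Delta_{res}=2\pi\frac{c_0}{2B}$ and $\lambda_c=2\pi c_0/(\omega_c-\frac{B}{2M})$. The lifted forward map sends $X\in\mathbb C^{K\times K}$ to $$\mathcal F(X)=\tfrac{1}{\sqrt{M\binom N2}}\Big((\mathbf L_i^m)^HX\,\mathbf L_j^m\Big)_{i<j,\;m},\qquad \mathbf L_i^m=\Big[e^{\mathrm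 i\frac{\omega_m}{c_0}\langle\hat{\mathbf a}_i+\hat{\mathbf a}^t,\mathbf x_k\rangle}\Big]_{k}.$$ It satisfies the rank-one RIP with constant $\delta$ if $(1-\delta)\|\rho\rho^H\|_F^2\le\|\mathcal F(\rho\rho^H)\|_2^2\le(1+\delta)\|\rho\rho^H\|_F^2$ for all $\rho\in\mathbb C^K$. The exact imaging condition of Generalized Wirtinger Flow (GWF) is that this holds with some $0\le\delta<0.214$. The upper bound for the restricted isometry constant (RIC) under study is $$\tilde\delta(K,N,M)=\frac{2\pi}{A}\,\frac{2\lambda_c\sqrt{L\Delta_{res}}}{\Delta^2\cos\phi\sqrt{\cos\phi}}+C\,\frac{K}{(N/A)^2}\,\lambda_c^{-3/2}.$$ Sampling is called adequate if $\frac{B}{2Mc_0}\,|\Phi_{i,j}^{k,k',l,l'}|\le\varepsilon\cdot2\pi$ for all receivers $i<j$ and all pixels $k,k',l,l'$, where $\Phi_{i,j}^{k,k',l,l'}=\langle\hat{\mathbf a}_i,\mathbf x_k-\mathbf x_{k'}\rangle-\langle\hat{\mathbf a}_j,\mathbf x_l-\mathbf x_{l'}\rangle+\langle\hat{\mathbf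 a}^t,\mathbf x_k-\mathbf x_{k'}-\mathbf x_l+\mathbf x_{l'}\rangle$. Corollary (Sample Complexity). Let $\tilde c_1=\frac{2\pi}{A}\frac{2\lambda_c\sqrt{\Delta_{res}}}{\Delta^{3/2}\cos\phi\sqrt{\cos\phi}}$ and $\tilde c_2=CA^2\lambda_c^{-3/2}$; for $M\ge1$ both lie between two positive constants that do not depend on $M$ (nor on $K$, $N$). (1) At fixed pixel spacing the RIC bound is at best of order $K^{1/4}$: there is $c>0$ with $\tilde\delta(K,N,M)\ge cK^{1/4}$ for all $K\ge1$, $N\ge2$, $M\ge1$. (2) For all choices of $N\ge 2$ and $M\ge 1$ as functions of $K=n^2\to\infty$: $\tilde\delta=\mathcal O(K^{1/4})$ if and only if $K^{3/4}=\mathcal O(N^2)$; if moreover the sampling is adequate for every $n$ and $\tilde\delta=\mathcal O(K^{1/4})$, then $L=\mathcal O(M)$ and $K^{5/4}=\mathcal O(MN^2)$. (3) If $N^2$ is of exact order $K^{3/4}$ and $M=\mathcal O(L)$, then $\tilde\delta$ is of exact order $K^{1/4}$ and the total sample complexity is $MN^2=\mathcal O(K^{5/4})$. Choices of $N$ and $M$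 with these properties and with adequate sampling for every $n$ exist. (4) For all $\kappa>0$, $n\ge1$, $N\ge2$, $M\ge1$ with $N^2\ge\kappa K^{3/4}$, $K=n^2$, we have $\tilde\delta(K,N,M)\le(\tilde c_1+\tilde c_2/\kappa)K^{1/4}$. Hence if $\mathcal F$ satisfies the rank-one RIP with constant $\tilde\delta(K,N,M)$, then it does so with constant $(\tilde c_1+\tilde c_2/\kappa)K^{1/4}$, and the exact imaging condition of GWF is satisfied when $(\tilde c_1+\tilde c_2/\kappa)K^{1/4}<0.214$. -/

import Mathlib

open Filter Asymptotics

noncomputable section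

/-- The fixed physical parameters of the multistatic imaging system. -/
structure ImagingSystem where
  /-- propagation speed `c₀` -/
  c0 : ℝ
  /-- center frequency `ω_c` -/
  omegaC : ℝ
  /-- bandwidth `B` -/
  B : ℝ
  /-- angular aperture `A` of the receivers -/
  A : ℝ
  /-- common elevation angle `φ` of the receivers and the transmitter -/
  phi : ℝ
  /-- pixel spacing `Δ` -/
  Delta : ℝ
  c0_pos : 0 < c0
  B_pos : 0 < B
  /-- the frequency band `[ω_c - B/2, ω_c + B/2]` consists of positive frequencies -/
  band_pos : B / 2 < omegaC
  A_pos : 0 < A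
  A_le : A ≤ 2 * Real.pi
  phi_nonneg : 0 ≤ phi
  phi_lt : phi < Real.pi / 2
  Delta_pos : 0 < Delta

namespace ImagingSystem

variable (S : ImagingSystem)

/-- Range resolution `Δ_res = 2π c₀ / (2B)`. -/
def rangeRes : ℝ := 2 * Real.pi * (S.c0 / (2 * S.B))

/-- Side length `L = √K Δ` of the square scene with `K` pixels. -/
def sideLength (K : ℕ) : ℝ := Real.sqrt K * S.Delta

/-- The frequency `ω_c' = ω_c - B / (2M)`. -/
def omegaC' (M : ℕ) : ℝ := S.omegaC - S.B / (2 * M)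

/-- The wavelength `λ_c = 2π c₀ / ω_c'`. -/
def wavelength (M : ℕ) : ℝ := 2 * Real.pi * S.c0 / S.omegaC' M

/-- The frequency samples `ω_c - B/2 + (m/M) B`, `m = 0, …, M-1`. -/
def freq {M : ℕ} (m : Fin M) : ℝ := S.omegaC - S.B / 2 + (m : ℝ) / (M : ℝ) * S.B

/-- The regular `n × n` grid with spacing `Δ`, centered at the origin of the ground plane;
it has `K = n²` points and lies in the square of side `L = n Δ`. -/
def pixel {n : ℕ} (k : Fin n × Fin n) : Fin 3 → ℝ :=
  ![((k.1 : ℝ) - ((n : ℝ) - 1) / 2) * S.Delta, ((k.2 : ℝ) - ((n : ℝ) - 1) / 2) * S.Delta, 0]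

/-- Look direction at azimuth `θ` and elevation `φ`. -/
def look (θ : ℝ) : Fin 3 → ℝ :=
  ![Real.cos S.phi * Real.cos θ, Real.cos S.phi * Real.sin θ, Real.sin S.phi]

/-- Look direction of the `i`-th of `N` receivers, at azimuth `θ_i = A i / N`. -/
def recvDir {N : ℕ} (i : Fin N) : Fin 3 → ℝ := S.look (S.A * (i : ℝ) / (N : ℝ))

/-- Look direction of the transmitter, over the `x₁`-axis. -/
def transDir : Fin 3 → ℝ := S.look 0

/-- The phase `Φ_{i,j}^{k,k',l,l'}`. -/
def phase {N n : ℕ} (i j : Fin N) (k k' l l' : Fin n × Fin n) : ℝ :=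
  dotProduct (S.recvDir i) (S.pixel k - S.pixel k')
    - dotProduct (S.recvDir j) (S.pixel l - S.pixel l')
    + dotProduct S.transDir (S.pixel k - S.pixel k' - S.pixel l + S.pixel l')

/-- Adequate frequency sampling: `B / (2 M c₀) · |Φ|` is at most the fraction `ε` of `2π`, for all
receiver pairs and all pixels. -/
def SmallPhase (ε : ℝ) (n N M : ℕ) : Prop :=
  ∀ i j : Fin N, i < j → ∀ k k' l l' : Fin n × Fin n,
    S.B / (2 * M * S.c0) * |S.phase i j k k' l l'| ≤ ε * (2 * Real.pi)

/-- The measurement vector `L_i^m` in the small-scene, far-field approximation, with unit amplitude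
(all receivers are isotropic and equidistant from the center of the scene). -/
def measVec {N n M : ℕ} (i : Fin N) (m : Fin M) (k : Fin n × Fin n) : ℂ :=
  Complex.exp (Complex.I *
    ((S.freq m / S.c0 * dotProduct (S.recvDir i + S.transDir) (S.pixel k) : ℝ) : ℂ))

/-- The lifted forward map `X ↦ (M · (N choose 2))^{-1/2} · ((L_i^m)ᴴ X L_j^m)_{i < j, m}`. -/
def forwardMap (n N M : ℕ) :
    Matrix (Fin n × Fin n) (Fin n × Fin n) ℂ →ₗ[ℂ]
      ({p : Fin N × Fin N // p.1 < p.2} × Fin M → ℂ) where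
  toFun X := fun q =>
    (((Real.sqrt ((M : ℝ) * (N.choose 2 : ℝ)))⁻¹ : ℝ) : ℂ) *
      dotProduct (star (S.measVec q.1.1.1 q.2)) (Matrix.mulVec X (S.measVec q.1.1.2 q.2))
  map_add' X Y := by
    funext q
    simp only [Matrix.add_mulVec, dotProduct_add, Pi.add_apply, mul_add]
  map_smul' c X := by
    funext q
    simp only [Matrix.smul_mulVec, dotProduct_smul, Pi.smul_apply, smul_eq_mul, RingHom.id_apply]
    ring

end ImagingSystem

/-- Restricted isometry property with constant `δ` over the rank-one positive semidefinite matrices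
`ρ ρᴴ`; the norms are the Frobenius norm and the Euclidean norm. -/
def RankOneRIP {ι κ : Type*} [Fintype ι] [Fintype κ]
    (F : Matrix ι ι ℂ →ₗ[ℂ] (κ → ℂ)) (δ : ℝ) : Prop :=
  ∀ ρ : ι → ℂ,
    (1 - δ) * (∑ k, ∑ l, ‖Matrix.vecMulVec ρ (star ρ) k l‖ ^ 2)
        ≤ ∑ q, ‖F (Matrix.vecMulVec ρ (star ρ)) q‖ ^ 2 ∧
      ∑ q, ‖F (Matrix.vecMulVec ρ (star ρ)) q‖ ^ 2
        ≤ (1 + δ) * (∑ k, ∑ l, ‖Matrix.vecMulVec ρ (star ρ) k l‖ ^ 2)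

/-- The exact imaging condition of Generalized Wirtinger Flow: the restricted isometry property over
rank-one positive semidefinite matrices with a constant less than `0.214`. -/
def ExactImagingCondition {ι κ : Type*} [Fintype ι] [Fintype κ]
    (F : Matrix ι ι ℂ →ₗ[ℂ] (κ → ℂ)) : Prop :=
  ∃ δ : ℝ, 0 ≤ δ ∧ δ < 0.214 ∧ RankOneRIP F δ

namespace ImagingSystem

variable (S : ImagingSystem)

/-- The RIC upper bound
`(2π/A) · 2 λ_c √(L Δ_res) / (Δ² cos φ √(cos φ)) + C · K / (N/A)² · λ_c^{-3/2}`
for `K` pixels, `N` receivers and `M` frequency samples, `C` being the constant of the order term. -/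
def ricBound (C : ℝ) (K N M : ℕ) : ℝ :=
  2 * Real.pi / S.A *
      (2 * S.wavelength M * Real.sqrt (S.sideLength K * S.rangeRes) /
        (S.Delta ^ 2 * Real.cos S.phi * Real.sqrt (Real.cos S.phi)))
    + C * ((K : ℝ) / ((N : ℝ) / S.A) ^ 2 * S.wavelength M ^ (-(3 / 2) : ℝ))

/-- The coefficient `(2π/A) · 2 λ_c √Δ_res / (Δ^{3/2} cos φ √(cos φ))`. -/
def coeff₁ (M : ℕ) : ℝ :=
  2 * Real.pi / S.A *
    (2 * S.wavelength M * Real.sqrt S.rangeRes /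
      (S.Delta ^ (3 / 2 : ℝ) * Real.cos S.phi * Real.sqrt (Real.cos S.phi)))

/-- The coefficient `C A² λ_c^{-3/2}`. -/
def coeff₂ (C : ℝ) (M : ℕ) : ℝ := C * S.A ^ 2 * S.wavelength M ^ (-(3 / 2) : ℝ)

end ImagingSystem

end

/-! ### The bound in terms of `K` and `N`, with coefficients of order one. -/

namespace ImagingSystem

variable (S : ImagingSystem)

/-! Since `L = √K Δ`, the factor `√L` contributes `K^{1/4}`, and the bound is `coeff₁ · K^{1/4} +
coeff₂ · K / N²` (`ricBound_eq`). Both coefficients depend on `M` only through the wavelength, which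
stays in a compact subset of the positive reals (`exists_coeff_bounds`). The first term cannot be
improved; the second is `O(K^{1/4})` exactly when `K^{3/4} = O(N²)`, because `x^{1/4} x^{3/4} = x`
(`div_sq_le_mul_rpow_iff`).

The largest phase has exact order `L`: `abs_phase_le` bounds it above, and a single pair of
far-apart pixels bounds it below (`SmallPhase.le_mul`). Adequate sampling therefore forces `M` to be
at least of order `L`, and a large enough multiple of `L` suffices. Multiplying the orders of `M`
and `N²` gives `√K · K^{3/4} = K^{5/4}`. -/

lemma cos_phi_pos : 0 < Real.cos S.phi :=
  Real.cos_pos_of_mem_Ioo ⟨by linarith [S.phi_nonneg, Real.pi_pos], S.phi_lt⟩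

lemma rangeRes_pos : 0 < S.rangeRes := by
  have := S.c0_pos
  have := S.B_pos
  have := Real.pi_pos
  unfold rangeRes
  positivity

lemma omegaC'_bounds {M : ℕ} (hM : 1 ≤ M) :
    S.omegaC - S.B / 2 ≤ S.omegaC' M ∧ S.omegaC' M ≤ S.omegaC := by
  have hB := S.B_pos
  have hM' : (1 : ℝ) ≤ M := by exact_mod_cast hM
  have h1 : S.B / (2 * M) ≤ S.B / 2 :=
    div_le_div_of_nonneg_left hB.le (by norm_num) (by linarith)
  have h2 : 0 ≤ S.B / (2 * M) := by positivity
  unfold omegaC'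
  constructor <;> linarith

/-- The wavelength is bounded above and below, uniformly in the number of samples. -/
lemma exists_wavelength_bounds :
    ∃ a b : ℝ, 0 < a ∧ ∀ M : ℕ, 1 ≤ M → a ≤ S.wavelength M ∧ S.wavelength M ≤ b := by
  have hnum : 0 < 2 * Real.pi * S.c0 := by
    have := S.c0_pos
    have := Real.pi_pos
    positivity
  have hlow : 0 < S.omegaC - S.B / 2 := by linarith [S.band_pos]
  have hC : 0 < S.omegaC := by linarith [S.B_pos]
  refine ⟨2 * Real.pi * S.c0 / S.omegaC, 2 * Real.pi * S.c0 / (S.omegaC - S.B / 2),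
    by positivity, fun M hM => ?_⟩
  obtain ⟨h1, h2⟩ := S.omegaC'_bounds hM
  exact ⟨div_le_div_of_nonneg_left hnum.le (hlow.trans_le h1) h2,
    div_le_div_of_nonneg_left hnum.le hlow h1⟩

lemma exists_coeff_bounds {C : ℝ} (hC : 0 < C) :
    ∃ a b : ℝ, 0 < a ∧ ∀ M : ℕ, 1 ≤ M →
      a ≤ S.coeff₁ M ∧ S.coeff₁ M ≤ b ∧ a ≤ S.coeff₂ C M ∧ S.coeff₂ C M ≤ b := by
  obtain ⟨a, b, ha, h⟩ := S.exists_wavelength_bounds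
  have hA := S.A_pos
  set p : ℝ := 2 * Real.pi / S.A * (2 * Real.sqrt S.rangeRes /
      (S.Delta ^ (3 / 2 : ℝ) * Real.cos S.phi * Real.sqrt (Real.cos S.phi))) with hp
  have hp0 : 0 < p := by
    have := S.cos_phi_pos
    have := S.rangeRes_pos
    have := S.Delta_pos
    have := Real.pi_pos
    positivity
  have hp1 : ∀ M, S.coeff₁ M = p * S.wavelength M := fun M => by
    unfold coeff₁
    rw [hp]
    ring
  set q : ℝ := C * S.A ^ 2
  have hq0 : 0 < q := by positivity
  have hb : 0 < b := ha.trans_le ((h 1 le_rfl).1.trans (h 1 le_rfl).2)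
  -- `coeff₁` increases with the wavelength and `coeff₂` decreases, so `a` and `b` trade places in
  -- the second entries.
  refine ⟨min (p * a) (q * b ^ (-(3 / 2) : ℝ)), max (p * b) (q * a ^ (-(3 / 2) : ℝ)),
    by positivity, fun M hM => ?_⟩
  obtain ⟨h1, h2⟩ := h M hM
  have hl : 0 < S.wavelength M := ha.trans_le h1
  refine ⟨(min_le_left _ _).trans ?_, le_trans ?_ (le_max_left _ _),
    (min_le_right _ _).trans ?_, le_trans ?_ (le_max_right _ _)⟩
  · rw [hp1]
    gcongr
  · rw [hp1]
    gcongr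
  · exact mul_le_mul_of_nonneg_left
      (Real.rpow_le_rpow_of_nonpos hl h2 (by norm_num)) hq0.le
  · exact mul_le_mul_of_nonneg_left
      (Real.rpow_le_rpow_of_nonpos ha h1 (by norm_num)) hq0.le

lemma ricBound_eq (C : ℝ) (K N M : ℕ) :
    S.ricBound C K N M =
      S.coeff₁ M * (K : ℝ) ^ (1 / 4 : ℝ) + S.coeff₂ C M * ((K : ℝ) / (N : ℝ) ^ 2) := by
  have hD := S.Delta_pos
  have hK : Real.sqrt (Real.sqrt K) = (K : ℝ) ^ (1 / 4 : ℝ) := by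
    rw [Real.sqrt_eq_rpow, Real.sqrt_eq_rpow, ← Real.rpow_mul (by positivity)]
    norm_num
  have hsq : Real.sqrt (S.sideLength K * S.rangeRes) =
      (K : ℝ) ^ (1 / 4 : ℝ) * Real.sqrt S.Delta * Real.sqrt S.rangeRes := by
    unfold sideLength
    rw [Real.sqrt_mul (by positivity), Real.sqrt_mul (by positivity), hK]
  have hDelta : S.Delta ^ 2 = S.Delta ^ (3 / 2 : ℝ) * Real.sqrt S.Delta := by
    rw [Real.sqrt_eq_rpow, ← Real.rpow_add hD, ← Real.rpow_natCast]
    norm_num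
  have hA := S.A_pos.ne'
  have hc := S.cos_phi_pos
  have hs : Real.sqrt S.Delta ≠ 0 := by positivity
  unfold ricBound coeff₁ coeff₂
  rw [hsq, hDelta]
  congr 1
  · field_simp
  · rw [div_pow, div_div_eq_mul_div]
    ring

/-! ### The size of the phases and the number of frequency samples. -/

lemma dotProduct_look_sub_eq (θ : ℝ) {n : ℕ} (k k' : Fin n × Fin n) :
    dotProduct (S.look θ) (S.pixel k - S.pixel k') =
      S.Delta * Real.cos S.phi * (Real.cos θ * ((k.1 : ℝ) - (k'.1 : ℝ))
        + Real.sin θ * ((k.2 : ℝ) - (k'.2 : ℝ))) := by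
  simp [dotProduct, look, pixel, Fin.sum_univ_three]
  ring

lemma abs_dotProduct_look_sub_le (θ : ℝ) {n : ℕ} (k k' : Fin n × Fin n) :
    |dotProduct (S.look θ) (S.pixel k - S.pixel k')| ≤ 2 * S.Delta * n := by
  have hfin : ∀ i j : Fin n, |(i : ℝ) - (j : ℝ)| ≤ n := fun i j => by
    have hi : (i : ℝ) < n := by exact_mod_cast i.2
    have hj : (j : ℝ) < n := by exact_mod_cast j.2
    have hi0 : (0 : ℝ) ≤ (i : ℝ) := by positivity
    have hj0 : (0 : ℝ) ≤ (j : ℝ) := by positivity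
    rw [abs_le]
    constructor <;> linarith
  have hD := S.Delta_pos
  have hc := S.cos_phi_pos
  have h1 : |Real.cos θ * ((k.1 : ℝ) - (k'.1 : ℝ))| ≤ 1 * n := by
    rw [abs_mul]
    exact mul_le_mul (Real.abs_cos_le_one θ) (hfin _ _) (abs_nonneg _) zero_le_one
  have h2 : |Real.sin θ * ((k.2 : ℝ) - (k'.2 : ℝ))| ≤ 1 * n := by
    rw [abs_mul]
    exact mul_le_mul (Real.abs_sin_le_one θ) (hfin _ _) (abs_nonneg _) zero_le_one
  rw [dotProduct_look_sub_eq, abs_mul, abs_of_pos (mul_pos hD hc)]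
  calc S.Delta * Real.cos S.phi * _ ≤ S.Delta * 1 * (2 * n) := by
        gcongr
        · exact Real.cos_le_one _
        · exact (abs_add_le _ _).trans (by linarith)
    _ = 2 * S.Delta * n := by ring

/-- The phase splits into four inner products of a look direction with a pixel difference, each at
most `2Δn`. -/
lemma abs_phase_le {N n : ℕ} (i j : Fin N) (k k' l l' : Fin n × Fin n) :
    |S.phase i j k k' l l'| ≤ 8 * S.Delta * n := by
  have e : S.phase i j k k' l l' =
      dotProduct (S.recvDir i) (S.pixel k - S.pixel k')
        - dotProduct (S.recvDir j) (S.pixel l - S.pixel l')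
        + (dotProduct S.transDir (S.pixel k - S.pixel k')
          - dotProduct S.transDir (S.pixel l - S.pixel l')) := by
    unfold phase
    rw [← dotProduct_sub]
    congr 2
    abel
  have h1 := abs_le.1 (S.abs_dotProduct_look_sub_le (S.A * (i : ℝ) / (N : ℝ)) k k')
  have h2 := abs_le.1 (S.abs_dotProduct_look_sub_le (S.A * (j : ℝ) / (N : ℝ)) l l')
  have h3 := abs_le.1 (S.abs_dotProduct_look_sub_le 0 k k')
  have h4 := abs_le.1 (S.abs_dotProduct_look_sub_le 0 l l')
  rw [e, abs_le]
  unfold recvDir transDir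
  constructor <;> linarith [h1.1, h1.2, h2.1, h2.2, h3.1, h3.2, h4.1, h4.2]

lemma smallPhase_of_le {ε : ℝ} (hε : 0 < ε) {n N M : ℕ} (hM : 1 ≤ M)
    (h : S.B * (8 * S.Delta) / (4 * Real.pi * ε * S.c0) * n ≤ M) : S.SmallPhase ε n N M := by
  intro i j _ k k' l l'
  have hM' : (0 : ℝ) < M := by exact_mod_cast hM
  have hc := S.c0_pos
  have hB := S.B_pos
  have hpi := Real.pi_pos
  calc S.B / (2 * M * S.c0) * |S.phase i j k k' l l'|
      ≤ S.B / (2 * M * S.c0) * (8 * S.Delta * n) := by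
        gcongr
        exact S.abs_phase_le i j k k' l l'
    _ ≤ ε * (2 * Real.pi) := by
        rw [div_mul_eq_mul_div, div_le_iff₀ (by positivity)] at h ⊢
        linarith

lemma SmallPhase.le_mul {S : ImagingSystem} {ε : ℝ} {n N M : ℕ} (hn : 2 ≤ n) (hN : 2 ≤ N)
    (hM : 1 ≤ M) (h : S.SmallPhase ε n N M) :
    (n : ℝ) * S.Delta ≤ 4 * Real.pi * ε * S.c0 / (S.B * Real.cos S.phi) * M := by
  have hM' : (0 : ℝ) < M := by exact_mod_cast hM
  have hc0 := S.c0_pos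
  have hB := S.B_pos
  have hD := S.Delta_pos
  have hc := S.cos_phi_pos
  have hn' : (2 : ℝ) ≤ n := by exact_mod_cast hn
  let z : Fin n := ⟨0, by omega⟩
  let t : Fin n := ⟨n - 1, by omega⟩
  -- Receiver `0` has azimuth `0`, the transmitter's direction, so a displacement along the whole
  -- first axis counts twice. The choice `l = l'` removes receiver `1`.
  have key := h ⟨0, by omega⟩ ⟨1, by omega⟩ (by simp) (t, z) (z, z) (z, z) (z, z)
  have ht : ((t : ℕ) : ℝ) = (n : ℝ) - 1 := by
    simp only [t]
    push_cast [Nat.cast_sub (show 1 ≤ n by omega)]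
    ring
  have e : S.phase (⟨0, by omega⟩ : Fin N) ⟨1, by omega⟩ (t, z) (z, z) (z, z) (z, z) =
      2 * (S.Delta * Real.cos S.phi * ((n : ℝ) - 1)) := by
    unfold phase recvDir transDir
    rw [sub_add_cancel, dotProduct_look_sub_eq, dotProduct_look_sub_eq, dotProduct_look_sub_eq, ht]
    simp [z]
    ring
  have hpos : 0 ≤ S.Delta * Real.cos S.phi * ((n : ℝ) - 1) :=
    mul_nonneg (by positivity) (by linarith)
  rw [e, abs_of_nonneg (by linarith), div_mul_eq_mul_div, div_le_iff₀ (by positivity)] at key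
  rw [div_mul_eq_mul_div, le_div_iff₀ (by positivity)]
  -- Here `n ≥ 2` enters, as `n ≤ 2(n - 1)`; for a single pixel all phases vanish.
  have h2 : S.B * (S.Delta * Real.cos S.phi) * n ≤
      S.B * (S.Delta * Real.cos S.phi) * (2 * ((n : ℝ) - 1)) :=
    mul_le_mul_of_nonneg_left (by linarith) (by positivity)
  linarith

end ImagingSystem

/-- The restricted isometry property is monotone in its constant. -/
lemma RankOneRIP.mono {ι κ : Type*} [Fintype ι] [Fintype κ]
    {F : Matrix ι ι ℂ →ₗ[ℂ] (κ → ℂ)} {δ δ' : ℝ} (h : RankOneRIP F δ) (hδ : δ ≤ δ') :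
    RankOneRIP F δ' := by
  intro ρ
  have hs : 0 ≤ ∑ k, ∑ l, ‖Matrix.vecMulVec ρ (star ρ) k l‖ ^ 2 := by positivity
  exact ⟨(mul_le_mul_of_nonneg_right (by linarith) hs).trans (h ρ).1,
    (h ρ).2.trans (mul_le_mul_of_nonneg_right (by linarith) hs)⟩

lemma rpow_quarter_mul_rpow_three_quarters {x : ℝ} (hx : 0 < x) :
    x ^ (1 / 4 : ℝ) * x ^ (3 / 4 : ℝ) = x := by
  rw [← Real.rpow_add hx]
  norm_num

/-- Cancel `x^{1/4}` from `x = x^{1/4} x^{3/4}`. The constant `c` is the same on both sides, so the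
equivalence passes directly to `O`-statements. -/
lemma div_sq_le_mul_rpow_iff {x y c : ℝ} (hx : 0 < x) (hy : 0 < y) :
    x / y ^ 2 ≤ c * x ^ (1 / 4 : ℝ) ↔ x ^ (3 / 4 : ℝ) ≤ c * y ^ 2 := by
  have hq : 0 < x ^ (1 / 4 : ℝ) := by positivity
  rw [div_le_iff₀ (by positivity)]
  nth_rw 1 [← rpow_quarter_mul_rpow_three_quarters hx]
  rw [mul_right_comm, mul_comm (c * y ^ 2), mul_le_mul_iff_right₀ hq]

lemma natCast_sq_rpow_five_quarters (n : ℕ) :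
    ((n ^ 2 : ℕ) : ℝ) ^ (5 / 4 : ℝ) = n * ((n ^ 2 : ℕ) : ℝ) ^ (3 / 4 : ℝ) := by
  have hn : (0 : ℝ) ≤ n := by positivity
  push_cast
  rw [← Real.rpow_natCast_mul hn, ← Real.rpow_natCast_mul hn]
  nth_rw 2 [← Real.rpow_one (n : ℝ)]
  rw [← Real.rpow_add_of_nonneg hn (by norm_num) (by norm_num)]
  norm_num

/-! ### Asymptotic orders and the existence of designs. -/

namespace ImagingSystem

variable (S : ImagingSystem)

lemma sideLength_sq (n : ℕ) : S.sideLength (n ^ 2) = n * S.Delta := by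
  unfold sideLength
  push_cast
  rw [Real.sqrt_sq (by positivity)]

lemma sideLength_isTheta :
    (fun n : ℕ => S.sideLength (n ^ 2)) =Θ[atTop] (fun n : ℕ => (n : ℝ)) := by
  simp_rw [sideLength_sq, mul_comm _ S.Delta]
  exact (isTheta_const_mul_left S.Delta_pos.ne').2 (isTheta_refl _ _)

lemma exists_mul_rpow_le_ricBound {C : ℝ} (hC : 0 < C) :
    ∃ c : ℝ, 0 < c ∧ ∀ K N M : ℕ, 1 ≤ M →
      c * (K : ℝ) ^ (1 / 4 : ℝ) ≤ S.ricBound C K N M := by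
  obtain ⟨a, b, ha, h⟩ := S.exists_coeff_bounds hC
  refine ⟨a, ha, fun K N M hM => ?_⟩
  obtain ⟨h1, -, h3, -⟩ := h M hM
  have h4 : 0 ≤ S.coeff₂ C M * ((K : ℝ) / (N : ℝ) ^ 2) :=
    mul_nonneg (ha.le.trans h3) (by positivity)
  rw [ricBound_eq]
  have h5 : a * (K : ℝ) ^ (1 / 4 : ℝ) ≤ S.coeff₁ M * (K : ℝ) ^ (1 / 4 : ℝ) := by gcongr
  linarith

lemma ricBound_isBigO_iff {C : ℝ} (hC : 0 < C) {N M : ℕ → ℕ} (hN : ∀ n, 2 ≤ N n)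
    (hM : ∀ n, 1 ≤ M n) :
    ((fun n : ℕ => S.ricBound C (n ^ 2) (N n) (M n)) =O[atTop]
        (fun n : ℕ => ((n ^ 2 : ℕ) : ℝ) ^ (1 / 4 : ℝ))) ↔
      ((fun n : ℕ => ((n ^ 2 : ℕ) : ℝ) ^ (3 / 4 : ℝ)) =O[atTop]
        (fun n : ℕ => (N n : ℝ) ^ 2)) := by
  obtain ⟨a, b, ha, h⟩ := S.exists_coeff_bounds hC
  have hb : 0 < b := ha.trans_le ((h 1 le_rfl).1.trans (h 1 le_rfl).2.1)
  have hnn : ∀ n, 0 ≤ ((n ^ 2 : ℕ) : ℝ) / (N n : ℝ) ^ 2 := fun n => by positivity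
  have hcoeff₁ : (fun n => S.coeff₁ (M n) * ((n ^ 2 : ℕ) : ℝ) ^ (1 / 4 : ℝ)) =O[atTop]
      (fun n : ℕ => ((n ^ 2 : ℕ) : ℝ) ^ (1 / 4 : ℝ)) := by
    refine IsBigO.of_bound b (Eventually.of_forall fun n => ?_)
    have := h _ (hM n)
    rw [norm_mul, Real.norm_of_nonneg (ha.le.trans this.1)]
    gcongr
    exact this.2.1
  have hcoeff₂ : (fun n => S.coeff₂ C (M n) * (((n ^ 2 : ℕ) : ℝ) / (N n : ℝ) ^ 2)) =Θ[atTop]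
      (fun n : ℕ => ((n ^ 2 : ℕ) : ℝ) / (N n : ℝ) ^ 2) := by
    refine ⟨IsBigO.of_bound b (Eventually.of_forall fun n => ?_),
      IsBigO.of_bound a⁻¹ (Eventually.of_forall fun n => ?_)⟩
    · have := h _ (hM n)
      rw [norm_mul, Real.norm_of_nonneg (ha.le.trans this.2.2.1)]
      gcongr
      exact this.2.2.2
    · have := h _ (hM n)
      rw [norm_mul, Real.norm_of_nonneg (ha.le.trans this.2.2.1), inv_mul_eq_div,
        le_div_iff₀ ha, mul_comm]
      gcongr
      exact this.2.2.1
  -- The first term is always `O(K^{1/4})`, so only `K / N²` decides.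
  have step : ((fun n : ℕ => S.ricBound C (n ^ 2) (N n) (M n)) =O[atTop]
        (fun n : ℕ => ((n ^ 2 : ℕ) : ℝ) ^ (1 / 4 : ℝ))) ↔
      ((fun n : ℕ => ((n ^ 2 : ℕ) : ℝ) / (N n : ℝ) ^ 2) =O[atTop]
        (fun n : ℕ => ((n ^ 2 : ℕ) : ℝ) ^ (1 / 4 : ℝ))) := by
    simp_rw [ricBound_eq]
    exact (hcoeff₁.add_iff_right).trans hcoeff₂.isBigO_congr_left
  rw [step, isBigO_iff, isBigO_iff]
  refine exists_congr fun c => eventually_congr ?_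
  filter_upwards [eventually_ge_atTop 1] with n hn
  have hK : (0 : ℝ) < ((n ^ 2 : ℕ) : ℝ) := by positivity
  have hNn : (0 : ℝ) < N n := by
    have := hN n
    positivity
  rw [Real.norm_of_nonneg (hnn n), Real.norm_of_nonneg (by positivity),
    Real.norm_of_nonneg (by positivity), Real.norm_of_nonneg (by positivity)]
  exact div_sq_le_mul_rpow_iff hK hNn

lemma sideLength_isBigO_of_smallPhase {ε : ℝ} {N M : ℕ → ℕ} (hN : ∀ n, 2 ≤ N n)
    (hM : ∀ n, 1 ≤ M n) (h : ∀ n, S.SmallPhase ε n (N n) (M n)) :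
    (fun n : ℕ => S.sideLength (n ^ 2)) =O[atTop] (fun n : ℕ => (M n : ℝ)) := by
  refine IsBigO.of_bound (4 * Real.pi * ε * S.c0 / (S.B * Real.cos S.phi)) ?_
  filter_upwards [eventually_ge_atTop 2] with n hn
  have hD := S.Delta_pos
  rw [sideLength_sq, Real.norm_of_nonneg (by positivity), Real.norm_of_nonneg (by positivity)]
  exact (h n).le_mul hn (hN n) (hM n)

lemma exists_smallPhase_design {ε : ℝ} (hε : 0 < ε) :
    ∃ N M : ℕ → ℕ, (∀ n, 2 ≤ N n) ∧ (∀ n, 1 ≤ M n) ∧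
      (∀ n, S.SmallPhase ε n (N n) (M n)) ∧
      ((fun n : ℕ => (N n : ℝ) ^ 2) =Θ[atTop]
        (fun n : ℕ => ((n ^ 2 : ℕ) : ℝ) ^ (3 / 4 : ℝ))) ∧
      ((fun n : ℕ => (M n : ℝ)) =O[atTop] (fun n : ℕ => S.sideLength (n ^ 2))) := by
  set q : ℝ := S.B * (8 * S.Delta) / (4 * Real.pi * ε * S.c0) with hq
  have hq0 : 0 < q := by
    have := S.B_pos
    have := S.Delta_pos
    have := S.c0_pos
    have := Real.pi_pos
    positivity
  -- `N ≈ n^{3/4}` makes `N²` of order `n^{3/2} = K^{3/4}`, and `q` is the threshold in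
  -- `smallPhase_of_le`. The summands `2` and `1` secure `N ≥ 2` and `M ≥ 1`, even at `n = 0`.
  refine ⟨fun n => ⌈(n : ℝ) ^ (3 / 4 : ℝ)⌉₊ + 2, fun n => ⌈q * n⌉₊ + 1,
    fun n => Nat.le_add_left _ _, fun n => Nat.le_add_left _ _,
    fun n => S.smallPhase_of_le hε (Nat.le_add_left _ _) ?_, ?_, ?_⟩
  · push_cast
    linarith [Nat.le_ceil (q * n)]
  · have e : ∀ n : ℕ, ((n ^ 2 : ℕ) : ℝ) ^ (3 / 4 : ℝ) = ((n : ℝ) ^ (3 / 4 : ℝ)) ^ 2 := fun n => by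
      push_cast
      rw [← Real.rpow_natCast_mul (by positivity), ← Real.rpow_mul_natCast (by positivity)]
      norm_num
    simp_rw [e]
    -- The `4` comes from `⌈x⌉ + 2 < x + 3 ≤ 4x` for `x ≥ 1`.
    refine IsTheta.pow ⟨IsBigO.of_bound 4 ?_, IsBigO.of_bound 1 (Eventually.of_forall fun n => ?_)⟩ 2
    · filter_upwards [eventually_ge_atTop 1] with n hn
      have h1 : (1 : ℝ) ≤ (n : ℝ) ^ (3 / 4 : ℝ) :=
        Real.one_le_rpow (by exact_mod_cast hn) (by norm_num)
      rw [Real.norm_of_nonneg (by positivity), Real.norm_of_nonneg (by positivity)]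
      push_cast
      linarith [Nat.ceil_lt_add_one (zero_le_one.trans h1)]
    · rw [Real.norm_of_nonneg (by positivity), Real.norm_of_nonneg (by positivity)]
      push_cast
      linarith [Nat.le_ceil ((n : ℝ) ^ (3 / 4 : ℝ))]
  · refine IsBigO.trans (IsBigO.of_bound (q + 2) ?_) S.sideLength_isTheta.2
    filter_upwards [eventually_ge_atTop 1] with n hn
    have h1 : (1 : ℝ) ≤ n := by exact_mod_cast hn
    rw [Real.norm_of_nonneg (by positivity), Real.norm_of_nonneg (by positivity)]
    push_cast
    linarith [Nat.ceil_lt_add_one (show 0 ≤ q * n by positivity)]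

lemma ricBound_nonneg {C : ℝ} (hC : 0 < C) {K N M : ℕ} (hM : 1 ≤ M) :
    0 ≤ S.ricBound C K N M := by
  obtain ⟨c, hc, h⟩ := S.exists_mul_rpow_le_ricBound hC
  exact le_trans (by positivity) (h K N M hM)

lemma ricBound_le {C : ℝ} (hC : 0 < C) {κ : ℝ} (hκ : 0 < κ) {K N M : ℕ} (hK : 1 ≤ K)
    (hN : 1 ≤ N) (hM : 1 ≤ M) (h : κ * (K : ℝ) ^ (3 / 4 : ℝ) ≤ (N : ℝ) ^ 2) :
    S.ricBound C K N M ≤ (S.coeff₁ M + S.coeff₂ C M / κ) * (K : ℝ) ^ (1 / 4 : ℝ) := by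
  obtain ⟨a, b, ha, hab⟩ := S.exists_coeff_bounds hC
  have hK' : (0 : ℝ) < K := by exact_mod_cast hK
  have hN' : (0 : ℝ) < N := by exact_mod_cast hN
  have h1 : (K : ℝ) / (N : ℝ) ^ 2 ≤ κ⁻¹ * (K : ℝ) ^ (1 / 4 : ℝ) := by
    rw [div_sq_le_mul_rpow_iff hK' hN', inv_mul_eq_div, le_div_iff₀ hκ, mul_comm]
    exact h
  have h2 := mul_le_mul_of_nonneg_left h1 (ha.le.trans (hab M hM).2.2.1)
  rw [ricBound_eq, add_mul, div_eq_mul_inv (S.coeff₂ C M), mul_assoc (S.coeff₂ C M)]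
  linarith

end ImagingSystem

theorem corollary2 (S : ImagingSystem) (C ε : ℝ) (hC : 0 < C) (hε : 0 < ε) :
    -- the coefficients are of order one, uniformly in the number of frequency samples
    (∃ a b : ℝ, 0 < a ∧ ∀ M : ℕ, 1 ≤ M →
      a ≤ S.coeff₁ M ∧ S.coeff₁ M ≤ b ∧ a ≤ S.coeff₂ C M ∧ S.coeff₂ C M ≤ b) ∧
    -- whatever the numbers of receivers and samples, the bound is at best of order `K^{1/4}`
    (∃ c : ℝ, 0 < c ∧ ∀ K N M : ℕ, 1 ≤ K → 2 ≤ N → 1 ≤ M →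
      c * (K : ℝ) ^ (1 / 4 : ℝ) ≤ S.ricBound C K N M) ∧
    -- statements for designs `N`, `M` depending on the size `K = n²` of the scene
    (∀ N M : ℕ → ℕ, (∀ n, 2 ≤ N n) → (∀ n, 1 ≤ M n) →
      -- the order `K^{1/4}` is attained exactly when `N²` is at least of order `K^{3/4}`
      (((fun n : ℕ => S.ricBound C (n ^ 2) (N n) (M n)) =O[atTop]
          (fun n : ℕ => ((n ^ 2 : ℕ) : ℝ) ^ (1 / 4 : ℝ))) ↔
        ((fun n : ℕ => ((n ^ 2 : ℕ) : ℝ) ^ (3 / 4 : ℝ)) =O[atTop]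
          (fun n : ℕ => (N n : ℝ) ^ 2))) ∧
      -- with adequate frequency sampling, attaining it takes at least order `L` frequency samples
      -- and at least order `K^{5/4}` samples in total
      ((∀ n, S.SmallPhase ε n (N n) (M n)) →
        ((fun n : ℕ => S.ricBound C (n ^ 2) (N n) (M n)) =O[atTop]
          (fun n : ℕ => ((n ^ 2 : ℕ) : ℝ) ^ (1 / 4 : ℝ))) →
        ((fun n : ℕ => S.sideLength (n ^ 2)) =O[atTop] (fun n : ℕ => (M n : ℝ))) ∧
        ((fun n : ℕ => ((n ^ 2 : ℕ) : ℝ) ^ (5 / 4 : ℝ)) =O[atTop]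
          (fun n : ℕ => (M n : ℝ) * (N n : ℝ) ^ 2))) ∧
      -- `N²` of order `K^{3/4}` and `M = O(L)` give the order `K^{1/4}` and `M N² = O(K^{5/4})`
      (((fun n : ℕ => (N n : ℝ) ^ 2) =Θ[atTop]
          (fun n : ℕ => ((n ^ 2 : ℕ) : ℝ) ^ (3 / 4 : ℝ))) →
        ((fun n : ℕ => (M n : ℝ)) =O[atTop] (fun n : ℕ => S.sideLength (n ^ 2))) →
        ((fun n : ℕ => S.ricBound C (n ^ 2) (N n) (M n)) =Θ[atTop]
          (fun n : ℕ => ((n ^ 2 : ℕ) : ℝ) ^ (1 / 4 : ℝ))) ∧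
        ((fun n : ℕ => (M n : ℝ) * (N n : ℝ) ^ 2) =O[atTop]
          (fun n : ℕ => ((n ^ 2 : ℕ) : ℝ) ^ (5 / 4 : ℝ))))) ∧
    -- such designs exist, with adequate frequency sampling
    (∃ N M : ℕ → ℕ, (∀ n, 2 ≤ N n) ∧ (∀ n, 1 ≤ M n) ∧
      (∀ n, S.SmallPhase ε n (N n) (M n)) ∧
      ((fun n : ℕ => (N n : ℝ) ^ 2) =Θ[atTop]
        (fun n : ℕ => ((n ^ 2 : ℕ) : ℝ) ^ (3 / 4 : ℝ))) ∧
      ((fun n : ℕ => (M n : ℝ)) =O[atTop] (fun n : ℕ => S.sideLength (n ^ 2)))) ∧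
    -- the bound at `N² ≥ κ K^{3/4}`, and what it gives for a forward map whose restricted isometry
    -- constant obeys the bound
    (∀ κ : ℝ, 0 < κ → ∀ n N M : ℕ, 1 ≤ n → 2 ≤ N → 1 ≤ M →
      κ * ((n ^ 2 : ℕ) : ℝ) ^ (3 / 4 : ℝ) ≤ (N : ℝ) ^ 2 →
      S.ricBound C (n ^ 2) N M ≤
        (S.coeff₁ M + S.coeff₂ C M / κ) * ((n ^ 2 : ℕ) : ℝ) ^ (1 / 4 : ℝ) ∧
      (RankOneRIP (S.forwardMap n N M) (S.ricBound C (n ^ 2) N M) →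
        RankOneRIP (S.forwardMap n N M)
          ((S.coeff₁ M + S.coeff₂ C M / κ) * ((n ^ 2 : ℕ) : ℝ) ^ (1 / 4 : ℝ)) ∧
        ((S.coeff₁ M + S.coeff₂ C M / κ) * ((n ^ 2 : ℕ) : ℝ) ^ (1 / 4 : ℝ) < 0.214 →
          ExactImagingCondition (S.forwardMap n N M)))) := by
  refine ⟨S.exists_coeff_bounds hC, ?_, fun N M hN hM => ⟨S.ricBound_isBigO_iff hC hN hM,
    fun hphase hric => ?_, fun hNK hML => ?_⟩, S.exists_smallPhase_design hε,
    fun κ hκ n N M hn hN hM hκN => ?_⟩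
  · obtain ⟨c, hc, h⟩ := S.exists_mul_rpow_le_ricBound hC
    exact ⟨c, hc, fun K N M _ _ hM => h K N M hM⟩
  · have hL := S.sideLength_isBigO_of_smallPhase hN hM hphase
    refine ⟨hL, ?_⟩
    simp_rw [natCast_sq_rpow_five_quarters]
    exact (S.sideLength_isTheta.2.trans hL).mul ((S.ricBound_isBigO_iff hC hN hM).1 hric)
  · refine ⟨⟨(S.ricBound_isBigO_iff hC hN hM).2 hNK.2, ?_⟩, ?_⟩
    · obtain ⟨c, hc, h⟩ := S.exists_mul_rpow_le_ricBound hC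
      refine IsBigO.of_bound c⁻¹ (Eventually.of_forall fun n => ?_)
      rw [Real.norm_of_nonneg (by positivity),
        Real.norm_of_nonneg (S.ricBound_nonneg hC (hM n)), inv_mul_eq_div, le_div_iff₀ hc, mul_comm]
      exact h _ _ _ (hM n)
    · simp_rw [natCast_sq_rpow_five_quarters]
      exact (hML.trans S.sideLength_isTheta.1).mul hNK.1
  · have hle := S.ricBound_le hC hκ (Nat.one_le_pow 2 n hn) (by omega) hM hκN
    refine ⟨hle, fun hRIP => ⟨hRIP.mono hle, fun hlt => ?_⟩⟩
    -- The witness is the larger constant; it is nonnegative because it dominates the nonnegative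
    -- bound.
    exact ⟨_, (S.ricBound_nonneg hC hM).trans hle, hlt, hRIP.mono hle⟩
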